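/- Theorem 4.7 (Theorem C). Let $k$ be a field of characteristic $p>3$, and let $P=k[x_1,x_2,x_3]$ be a polynomial Poisson algebra which is graded for $\deg x_1=\deg x_2=\deg x_3=1$ (that is, $\{P_i,P_j\}\subseteq P_{i+j}$ for all $i,j\ge 0$) and whose bracket is not identically zero. Here a nonzero $f\in P$ is Poisson normal if $\{a,f\}\in fP$ for all $a\in P$; for such $f$ let $\delta_f=f^{-1}\{-,f\}$, a derivation of $P$, and let $\mathrm{loz}(P)$ be the set of all these $\delta_f$ (the log-ozone group of $P$). The modular derivation of $P$ is $\phi(a)=\sum_{j=1}^3\frac{\partial}{\partial x_j}\{x_j,a\}$, and $P$ is unimodular if $\phi=0$. For $\Omega\in k[x_1,x_2,x_3]$, $P_\Omega$ denotes the Poisson algebra $k[x_1,x_2,x_3]$ with $\{x_1,x_2\}=\frac{\partial\Omega}{\partial x_3}$, $\{x_2,x_3\}=\frac{\partial\Omega}{\partial x_1}$, $\{x_3,x_1\}=\frac{\partial\Omega}{\partial x_2}$. Then $\mathrm{loz}(P)=0$ if and only if $P$ is unimodular and isomorphic, as a Poisson algebra, to $P_\Omega$ for some homogeneous $\Omega\in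 k[x_1,x_2,x_3]$ of degree $3$ such that $\Omega$ is irreducible or $\Omega=x_1^3$. In particular, if $P$ is not unimodular, then $\phi\in\mathrm{loz}(P)$ and $\mathrm{loz}(P)\neq 0$. -/

import Mathlib

open MvPolynomial

/-- A Poisson bracket on a commutative `k`-algebra `A`: a `k`-bilinear Lie bracket such that
`{a, -}` is a derivation for every `a`. -/
structure PoissonBracket (k A : Type*) [Field k] [CommRing A] [Algebra k A] where
  /-- the bracket `{a, b}` -/
  br : A →ₗ[k] A →ₗ[k] A
  br_self : ∀ a, br a a = 0
  jacobi : ∀ a b c, br a (br b c) + br b (br c a) + br c (br a b) = 0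
  br_mul : ∀ a b c, br a (b * c) = b * br a c + c * br a b

namespace PoissonBracket

section General

variable {k A : Type*} [Field k] [CommRing A] [Algebra k A]

theorem br_skew (B : PoissonBracket k A) (a b : A) : B.br a b = -B.br b a := by
  have h := B.br_self (a + b)
  simp only [map_add, LinearMap.add_apply, B.br_self, zero_add, add_zero] at h
  exact eq_neg_of_add_eq_zero_right h

theorem br_mul_left (B : PoissonBracket k A) (a b c : A) :
    B.br (a * b) c = a * B.br b c + b * B.br a c := by
  rw [B.br_skew, B.br_mul, B.br_skew c b, B.br_skew c a]
  ring

/-- `f` is Poisson normal if `{a, f} ∈ f A` for all `a`. -/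
def IsNormal (B : PoissonBracket k A) (f : A) : Prop :=
  ∀ a, f ∣ B.br a f

/-- The log-ozone derivation `δ_f = f⁻¹ {-, f}` of a regular Poisson normal element `f`:
`δ_f a` is the unique element with `{a, f} = f * δ_f a`. -/
noncomputable def logOzone (B : PoissonBracket k A) (f : A) (hr : IsRegular f)
    (hn : B.IsNormal f) : Derivation k A A :=
  have spec : ∀ a, f * (hn a).choose = B.br a f := fun a => (hn a).choose_spec.symm
  Derivation.mk'
    { toFun := fun a => (hn a).choose
      map_add' := fun a b => hr.left (by
        change f * (hn (a + b)).choose = f * ((hn a).choose + (hn b).choose)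
        rw [mul_add, spec, spec, spec, map_add, LinearMap.add_apply])
      map_smul' := fun c a => hr.left (by
        change f * (hn (c • a)).choose = f * (c • (hn a).choose)
        rw [mul_smul_comm, spec, spec, map_smul, LinearMap.smul_apply]) }
    (fun a b => hr.left (by
      change f * (hn (a * b)).choose = f * (a * (hn b).choose + b * (hn a).choose)
      rw [mul_add, mul_left_comm f a, mul_left_comm f b, spec, spec, spec, B.br_mul_left]))

theorem mul_logOzone (B : PoissonBracket k A) (f : A) (hr : IsRegular f)
    (hn : B.IsNormal f) (a : A) : f * B.logOzone f hr hn a = B.br a f :=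
  (hn a).choose_spec.symm

/-- The (underlying set of the) log-ozone group: all `δ_f` with `f` regular and Poisson normal. -/
def loz (B : PoissonBracket k A) : Set (Derivation k A A) :=
  {δ | ∃ (f : A) (hr : IsRegular f) (hn : B.IsNormal f), δ = B.logOzone f hr hn}

/-- Isomorphism of Poisson algebras. -/
def Isomorphic {A' : Type*} [CommRing A'] [Algebra k A']
    (B : PoissonBracket k A) (B' : PoissonBracket k A') : Prop :=
  ∃ e : A ≃ₐ[k] A', ∀ a b, e (B.br a b) = B'.br (e a) (e b)

end General

section Polynomial

variable {k : Type*} [Field k] {n : ℕ}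

/-- The bracket is graded for the standard grading with `deg x_i = 1`:
`{P_i, P_j} ⊆ P_{i+j}`. -/
def IsGraded (B : PoissonBracket k (MvPolynomial (Fin n) k)) : Prop :=
  ∀ (i j : ℕ) (f g : MvPolynomial (Fin n) k),
    f.IsHomogeneous i → g.IsHomogeneous j → (B.br f g).IsHomogeneous (i + j)

theorem sum_pderiv_mul_br (B : PoissonBracket k (MvPolynomial (Fin n) k))
    (f g : MvPolynomial (Fin n) k) :
    ∑ j, pderiv j f * B.br (X j) g = B.br f g := by
  classical
  let D₁ : Derivation k (MvPolynomial (Fin n) k) (MvPolynomial (Fin n) k) :=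
    ∑ j, B.br (X j) g • pderiv j
  let D₂ : Derivation k (MvPolynomial (Fin n) k) (MvPolynomial (Fin n) k) :=
    Derivation.mk' (B.br.flip g) (fun a b => by
      simp only [LinearMap.flip_apply, smul_eq_mul, B.br_mul_left])
  have hD : ∀ a, D₁ a = ∑ j, pderiv j a * B.br (X j) g := fun a => by
    have : D₁ a = ∑ j, (B.br (X j) g • pderiv j : Derivation k _ _) a := by
      change Derivation.coeFnAddMonoidHom D₁ a = _
      simp only [D₁, map_sum, Finset.sum_apply]
      rfl
    rw [this]
    exact Finset.sum_congr rfl fun j _ => mul_comm _ _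
  have h : D₁ = D₂ := by
    refine MvPolynomial.derivation_ext fun i => ?_
    rw [hD]
    have : D₂ (X i) = B.br (X i) g := rfl
    rw [this]
    simp [pderiv_X, Pi.single_apply]
  rw [← hD, h]
  rfl

/-- The modular derivation `φ(f) = ∑ j, ∂/∂x_j {x_j, f}`. -/
noncomputable def modular (B : PoissonBracket k (MvPolynomial (Fin n) k)) :
    Derivation k (MvPolynomial (Fin n) k) (MvPolynomial (Fin n) k) :=
  Derivation.mk'
    (∑ j, (pderiv j).toLinearMap ∘ₗ B.br (X j))
    (fun a b => by
      have h₁ := B.sum_pderiv_mul_br a b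
      have h₂ := B.sum_pderiv_mul_br b a
      rw [B.br_skew b a, ← h₁] at h₂
      simp only [LinearMap.sum_apply, LinearMap.comp_apply, Derivation.coeFn_coe, B.br_mul, map_add, Derivation.leibniz, smul_eq_mul,
        Finset.sum_add_distrib, Finset.mul_sum]
      have e₁ : ∑ j, B.br (X j) b * pderiv j a = ∑ j, pderiv j a * B.br (X j) b :=
        Finset.sum_congr rfl fun _ _ => mul_comm _ _
      have e₂ : ∑ j, B.br (X j) a * pderiv j b = ∑ j, pderiv j b * B.br (X j) a :=
        Finset.sum_congr rfl fun _ _ => mul_comm _ _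
      rw [e₁, e₂, h₂]
      ring)

theorem modular_apply (B : PoissonBracket k (MvPolynomial (Fin n) k))
    (f : MvPolynomial (Fin n) k) : B.modular f = ∑ j, pderiv j (B.br (X j) f) := by
  simp [modular]

/-- `P` is unimodular if its modular derivation vanishes. -/
def IsUnimodular (B : PoissonBracket k (MvPolynomial (Fin n) k)) : Prop :=
  B.modular = 0

end Polynomial

section Jacobian

variable {k : Type*} [Field k]

/-- The Poisson algebra `P_Ω` on `k[x_1, x_2, x_3]`, with `x_i` written `X (i - 1)`. Its bracket
is the Jacobian determinant of `(f, g, Ω)`, the Poisson bracket determined by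
`{x_1, x_2} = ∂Ω/∂x_3`, `{x_2, x_3} = ∂Ω/∂x_1`, `{x_3, x_1} = ∂Ω/∂x_2`. -/
noncomputable def ofPotential (Ω : MvPolynomial (Fin 3) k) :
    PoissonBracket k (MvPolynomial (Fin 3) k) where
  br := LinearMap.mk₂ k
    (fun f g =>
      (pderiv 0 f * pderiv 1 g - pderiv 1 f * pderiv 0 g) * pderiv 2 Ω +
      (pderiv 1 f * pderiv 2 g - pderiv 2 f * pderiv 1 g) * pderiv 0 Ω +
      (pderiv 2 f * pderiv 0 g - pderiv 0 f * pderiv 2 g) * pderiv 1 Ω)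
    (fun _ _ _ => by simp only [map_add]; ring)
    (fun _ _ _ => by simp only [smul_eq_C_mul, pderiv_C_mul]; ring)
    (fun _ _ _ => by simp only [map_add]; ring)
    (fun _ _ _ => by simp only [smul_eq_C_mul, pderiv_C_mul]; ring)
  br_self a := by simp only [LinearMap.mk₂_apply]; ring
  jacobi a b c := by
    have comm : ∀ (i j : Fin 3) (f : MvPolynomial (Fin 3) k),
        pderiv i (pderiv j f) = pderiv j (pderiv i f) := fun i j f => by
      have h : ⁅pderiv (R := k) i, pderiv (R := k) j⁆ = 0 := by
        classical
        refine MvPolynomial.derivation_ext fun l => ?_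
        rw [Derivation.commutator_apply]
        simp only [pderiv_X, Pi.single_apply, Derivation.coe_zero, Pi.zero_apply]
        split_ifs <;> simp
      have := congrArg (fun D => D f) h
      simpa [Derivation.commutator_apply, sub_eq_zero] using this
    simp only [LinearMap.mk₂_apply, map_add, map_sub, Derivation.leibniz, smul_eq_mul]
    simp only [comm 1 0, comm 2 0, comm 2 1]
    ring
  br_mul a b c := by
    simp only [LinearMap.mk₂_apply, Derivation.leibniz, smul_eq_mul]; ring

theorem ofPotential_X (Ω : MvPolynomial (Fin 3) k) :
    (ofPotential Ω).br (X 0) (X 1) = pderiv 2 Ω ∧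
    (ofPotential Ω).br (X 1) (X 2) = pderiv 0 Ω ∧
    (ofPotential Ω).br (X 2) (X 0) = pderiv 1 Ω := by
  classical
  refine ⟨?_, ?_, ?_⟩ <;> simp [ofPotential, pderiv_X]

end Jacobian

end PoissonBracket

/-!
Encode the bracket by the vector `w = ({x₁, x₂}, {x₂, x₀}, {x₀, x₁})` of quadratic forms. Then
`{xᵢ, f}` is the `i`-th entry of `-w × ∇f`, the modular derivation is `φ = -curl w`, the Jacobi
identity is `w · curl w = 0`, and Euler's identity gives `∇(x · w) = 3 w + x × curl w`.

The modular derivation always lies in the log-ozone group (`modular_mem_loz`). If `T = x · w` is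
nonzero, these identities give `{xᵢ, T} = -φ(xᵢ) T` (`br_X_cubic`). If `T = 0`, then
`3 w = -x × curl w`, and every cubic form `f` with `φ(f) = 0` satisfies `{xᵢ, f} = -φ(xᵢ) f`
(`br_X_of_cubic_eq_zero`); such a form exists because `φ` is linear of trace zero
(`exists_invariant`): over the algebraic closure it is a product of three eigenforms. In both cases
the power `p - 1` of the normal element has log-ozone derivation `φ`. Hence a trivial log-ozone group
forces unimodularity, and then `w = ∇Ω` for `Ω = T / 3` (`isomorphic_ofPotential_cubic`).

For a potential `Ω`, an element `f` is normal when it divides `∇f × ∇Ω`. If `Ω = l q` with `l` linear,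
then `l` is normal, so triviality of the group gives `∇l × ∇q = 0`, which makes `Ω` a multiple of
`l ^ 3`; a linear change of variables turns it into `x₀ ^ 3`
(`isomorphic_X_pow_of_not_irreducible`). Conversely, let `Ω` be irreducible. Normal elements may be
taken homogeneous (`loz_eq_zero_of_homogeneous`), and the cross product of `∇f × ∇Ω` with `x` shows
that `f` divides `Ω ∇f`, so that `f` is a power of `Ω` times a polynomial of zero gradient, which is
central (`loz_ofPotential_of_irreducible`). The potential `x₀ ^ 3` is treated the same way with `x₀`
in the role of the prime. No step needs `k` to be perfect or algebraically closed.
-/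

open MvPolynomial

namespace PoissonBracket

/-! ### The log-ozone group -/

section Loz

variable {k A : Type*} [Field k] [CommRing A] [Algebra k A]

theorem mem_loz_iff [IsDomain A] (B : PoissonBracket k A) (δ : Derivation k A A) :
    δ ∈ B.loz ↔ ∃ f : A, f ≠ 0 ∧ ∀ a, B.br a f = f * δ a := by
  constructor
  · rintro ⟨f, hr, hn, rfl⟩
    exact ⟨f, hr.ne_zero, fun a => (B.mul_logOzone f hr hn a).symm⟩
  · rintro ⟨f, hf, h⟩
    have hr : IsRegular f := IsRegular.of_ne_zero hf
    have hn : B.IsNormal f := fun a => ⟨δ a, h a⟩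
    refine ⟨f, hr, hn, Derivation.ext fun a => hr.left ?_⟩
    change f * δ a = f * _
    rw [← h, B.mul_logOzone f hr hn a]

theorem br_algebraMap (B : PoissonBracket k A) (a : A) (c : k) : B.br a (algebraMap k A c) = 0 := by
  have h := B.br_mul a 1 1
  rw [Algebra.algebraMap_eq_smul_one, map_smul]
  simp only [mul_one, one_mul, left_eq_add] at h
  rw [h, smul_zero]

theorem loz_eq_zero_iff [IsDomain A] (B : PoissonBracket k A) :
    B.loz = {0} ↔ ∀ f, B.IsNormal f → ∀ a, B.br a f = 0 := by
  constructor
  · intro h f hn a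
    by_cases hf : f = 0
    · simp [hf]
    · have hr : IsRegular f := IsRegular.of_ne_zero hf
      have hm : B.logOzone f hr hn ∈ B.loz := ⟨f, hr, hn, rfl⟩
      rw [h, Set.mem_singleton_iff] at hm
      rw [← B.mul_logOzone f hr hn a, hm]
      simp
  · intro h
    ext δ
    rw [mem_loz_iff, Set.mem_singleton_iff]
    constructor
    · rintro ⟨f, hf, hδ⟩
      ext a
      have := h f (fun a => ⟨δ a, hδ a⟩) a
      rw [hδ, mul_eq_zero] at this
      simpa [hf] using this
    · rintro rfl
      exact ⟨1, one_ne_zero, fun a => by simpa using B.br_algebraMap a 1⟩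

theorem Isomorphic.symm {A' : Type*} [CommRing A'] [Algebra k A'] {B : PoissonBracket k A}
    {B' : PoissonBracket k A'} (h : B.Isomorphic B') : B'.Isomorphic B := by
  obtain ⟨e, he⟩ := h
  exact ⟨e.symm, fun a b => e.injective (by rw [he]; simp)⟩

theorem Isomorphic.trans {A' A'' : Type*} [CommRing A'] [Algebra k A'] [CommRing A'']
    [Algebra k A''] {B : PoissonBracket k A} {B' : PoissonBracket k A'}
    {B'' : PoissonBracket k A''} (h : B.Isomorphic B') (h' : B'.Isomorphic B'') :
    B.Isomorphic B'' := by
  obtain ⟨e, he⟩ := h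
  obtain ⟨e', he'⟩ := h'
  exact ⟨e.trans e', fun a b => by simp [he, he']⟩

theorem Isomorphic.loz_eq_zero {A' : Type*} [CommRing A'] [Algebra k A'] [IsDomain A] [IsDomain A']
    {B : PoissonBracket k A} {B' : PoissonBracket k A'} (h : B.Isomorphic B')
    (h' : B'.loz = {0}) : B.loz = {0} := by
  rw [loz_eq_zero_iff] at h' ⊢
  obtain ⟨e, he⟩ := h
  intro f hn a
  apply e.injective
  rw [he, map_zero]
  refine h' _ (fun b => ?_) _
  obtain ⟨b, rfl⟩ := e.surjective b
  rw [← he]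
  exact map_dvd e (hn b)

theorem natCast_ne_zero_of_lt (p : ℕ) [CharP k p] {n : ℕ} (h0 : n ≠ 0) (h : n < p) :
    (n : k) ≠ 0 := fun hn =>
  absurd (Nat.le_of_dvd (Nat.pos_of_ne_zero h0) ((CharP.cast_eq_zero_iff k p n).1 hn)) (by omega)

/-- If `f` has log-ozone value `g` at `a`, then `f ^ n` has value `n g`. -/
theorem br_pow_of_br_eq_mul (B : PoissonBracket k A) {a f g : A} (h : B.br a f = f * g) (n : ℕ) :
    B.br a (f ^ n) = f ^ n * (n * g) := by
  induction n with
  | zero => simpa using B.br_algebraMap a 1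
  | succ n ih => rw [pow_succ, B.br_mul, h, ih]; push_cast; ring

end Loz

/-! ### Brackets and derivations on generators -/

section Generators

variable {k : Type*} [Field k] {n : ℕ}

/-- For fixed `f`, both sides are derivations in `a`, so it suffices to compare them on generators. -/
theorem br_eq_mul_of_X (B : PoissonBracket k (MvPolynomial (Fin n) k))
    {f : MvPolynomial (Fin n) k}
    (δ : Derivation k (MvPolynomial (Fin n) k) (MvPolynomial (Fin n) k))
    (h : ∀ i, B.br (X i) f = f * δ (X i)) (a : MvPolynomial (Fin n) k) :
    B.br a f = f * δ a := by
  induction a using MvPolynomial.induction_on with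
  | C r =>
    rw [B.br_skew, ← algebraMap_eq, br_algebraMap, Derivation.map_algebraMap, mul_zero, neg_zero]
  | add p q hp hq => simp only [map_add, LinearMap.add_apply, hp, hq, mul_add]
  | mul_X p i hp =>
    rw [B.br_mul_left, hp, h, Derivation.leibniz, smul_eq_mul, smul_eq_mul]
    ring

theorem derivation_eq_sum_pderiv
    (δ : Derivation k (MvPolynomial (Fin n) k) (MvPolynomial (Fin n) k))
    (f : MvPolynomial (Fin n) k) : δ f = ∑ j, pderiv j f * δ (X j) := by
  classical
  induction f using MvPolynomial.induction_on with
  | C r => simp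
  | add p q hp hq => simp only [map_add, hp, hq, add_mul, Finset.sum_add_distrib]
  | mul_X p i hp =>
    simp only [Derivation.leibniz, smul_eq_mul, hp, add_mul, Finset.sum_add_distrib,
      Finset.mul_sum, pderiv_X, Pi.single_apply, mul_assoc, mul_ite, ite_mul, mul_zero, zero_mul,
      mul_one, Finset.sum_ite_eq, Finset.mem_univ, if_true]

/-- A change of variables that respects the brackets of the generators is an isomorphism of Poisson
algebras. -/
theorem isomorphic_of_X {A : Type*} [CommRing A] [Algebra k A]
    (B : PoissonBracket k (MvPolynomial (Fin n) k)) (B' : PoissonBracket k A)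
    (e : MvPolynomial (Fin n) k ≃ₐ[k] A)
    (h : ∀ i j, e (B.br (X i) (X j)) = B'.br (e (X i)) (e (X j))) : B.Isomorphic B' := by
  refine ⟨e, fun a b => ?_⟩
  have key : ∀ c, (∀ i, e (B.br c (X i)) = B'.br (e c) (e (X i))) →
      ∀ b, e (B.br c b) = B'.br (e c) (e b) := by
    intro c hc b
    induction b using MvPolynomial.induction_on with
    | C r =>
      rw [← algebraMap_eq, AlgEquiv.commutes, br_algebraMap, br_algebraMap, map_zero]
    | add p q hp hq => simp only [map_add, hp, hq]
    | mul_X p i hp => rw [B.br_mul, map_add, map_mul, map_mul, hp, hc, map_mul, B'.br_mul]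
  refine key a (fun i => ?_) b
  rw [B.br_skew, map_neg, key _ (h i), ← B'.br_skew]

end Generators

/-! ### Quadratic brackets in three variables -/

section ThreeVariables

variable {k : Type*} [Field k] (B : PoissonBracket k (MvPolynomial (Fin 3) k))

theorem br_X_zero (g : MvPolynomial (Fin 3) k) : B.br (X 0) g =
    B.br (X 0) (X 1) * pderiv 1 g - B.br (X 2) (X 0) * pderiv 2 g := by
  rw [B.br_skew, ← B.sum_pderiv_mul_br, Fin.sum_univ_three, B.br_self, B.br_skew (X 1) (X 0)]
  ring

theorem br_X_one (g : MvPolynomial (Fin 3) k) : B.br (X 1) g =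
    B.br (X 1) (X 2) * pderiv 2 g - B.br (X 0) (X 1) * pderiv 0 g := by
  rw [B.br_skew, ← B.sum_pderiv_mul_br, Fin.sum_univ_three, B.br_self, B.br_skew (X 2) (X 1)]
  ring

theorem br_X_two (g : MvPolynomial (Fin 3) k) : B.br (X 2) g =
    B.br (X 2) (X 0) * pderiv 0 g - B.br (X 1) (X 2) * pderiv 1 g := by
  rw [B.br_skew, ← B.sum_pderiv_mul_br, Fin.sum_univ_three, B.br_self, B.br_skew (X 0) (X 2)]
  ring

theorem modular_X_zero : B.modular (X 0) =
    pderiv 2 (B.br (X 2) (X 0)) - pderiv 1 (B.br (X 0) (X 1)) := by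
  rw [modular_apply, Fin.sum_univ_three, B.br_self, B.br_skew (X 1) (X 0)]
  simp only [map_zero, map_neg]; ring

theorem modular_X_one : B.modular (X 1) =
    pderiv 0 (B.br (X 0) (X 1)) - pderiv 2 (B.br (X 1) (X 2)) := by
  rw [modular_apply, Fin.sum_univ_three, B.br_self, B.br_skew (X 2) (X 1)]
  simp only [map_zero, map_neg]; ring

theorem modular_X_two : B.modular (X 2) =
    pderiv 1 (B.br (X 1) (X 2)) - pderiv 0 (B.br (X 2) (X 0)) := by
  rw [modular_apply, Fin.sum_univ_three, B.br_self, B.br_skew (X 0) (X 2)]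
  simp only [map_zero, map_neg]; ring

theorem isHomogeneous_br_X (h : B.IsGraded) (i j : Fin 3) :
    (B.br (X i) (X j)).IsHomogeneous 2 :=
  h 1 1 _ _ (isHomogeneous_X k i) (isHomogeneous_X k j)

/-- The cubic form `x · w`, where `w = ({x₁, x₂}, {x₂, x₀}, {x₀, x₁})` encodes the bracket. In the
unimodular case it is `3` times a potential of the bracket. -/
noncomputable def cubic : MvPolynomial (Fin 3) k :=
  X 0 * B.br (X 1) (X 2) + X 1 * B.br (X 2) (X 0) + X 2 * B.br (X 0) (X 1)

theorem isHomogeneous_cubic (h : B.IsGraded) : B.cubic.IsHomogeneous 3 :=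
  (((isHomogeneous_X k 0).mul (B.isHomogeneous_br_X h _ _)).add
    ((isHomogeneous_X k 1).mul (B.isHomogeneous_br_X h _ _))).add
    ((isHomogeneous_X k 2).mul (B.isHomogeneous_br_X h _ _))

theorem euler_three {f : MvPolynomial (Fin 3) k} {n : ℕ} (h : f.IsHomogeneous n) :
    X 0 * pderiv 0 f + X 1 * pderiv 1 f + X 2 * pderiv 2 f = n • f := by
  rw [← h.sum_X_mul_pderiv, Fin.sum_univ_three]

theorem C_inv_three_mul (h3 : (3 : k) ≠ 0) : (C 3⁻¹ * 3 : MvPolynomial (Fin 3) k) = 1 := by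
  rw [← map_ofNat C 3, ← C_mul, inv_mul_cancel₀ h3, C_1]

/-- The vector identity `∇(x · w) = 3 w + x × curl w`, valid for `w` homogeneous of degree `2`; here
`curl w = -φ(x)`. -/
theorem pderiv_cubic (h : B.IsGraded) :
    (pderiv 0 B.cubic = 3 * B.br (X 1) (X 2)
      + (X 2 * B.modular (X 1) - X 1 * B.modular (X 2))) ∧
    (pderiv 1 B.cubic = 3 * B.br (X 2) (X 0)
      + (X 0 * B.modular (X 2) - X 2 * B.modular (X 0))) ∧
    (pderiv 2 B.cubic = 3 * B.br (X 0) (X 1)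
      + (X 1 * B.modular (X 0) - X 0 * B.modular (X 1))) := by
  have e0 := euler_three (B.isHomogeneous_br_X h 1 2)
  have e1 := euler_three (B.isHomogeneous_br_X h 2 0)
  have e2 := euler_three (B.isHomogeneous_br_X h 0 1)
  rw [modular_X_zero, modular_X_one, modular_X_two, cubic]
  simp only [nsmul_eq_mul, Nat.cast_ofNat] at e0 e1 e2
  simp only [map_add, Derivation.leibniz, smul_eq_mul, pderiv_X_self,
    pderiv_X_of_ne (show (0 : Fin 3) ≠ 1 by decide),
    pderiv_X_of_ne (show (0 : Fin 3) ≠ 2 by decide),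
    pderiv_X_of_ne (show (1 : Fin 3) ≠ 0 by decide),
    pderiv_X_of_ne (show (1 : Fin 3) ≠ 2 by decide),
    pderiv_X_of_ne (show (2 : Fin 3) ≠ 0 by decide),
    pderiv_X_of_ne (show (2 : Fin 3) ≠ 1 by decide)]
  refine ⟨?_, ?_, ?_⟩
  · linear_combination e0
  · linear_combination e1
  · linear_combination e2

/-- In terms of `w`, the Jacobi identity reads `w · curl w = 0`. -/
theorem br_dot_modular : B.br (X 1) (X 2) * B.modular (X 0) + B.br (X 2) (X 0) * B.modular (X 1)
    + B.br (X 0) (X 1) * B.modular (X 2) = 0 := by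
  have hJ := B.jacobi (X 0) (X 1) (X 2)
  rw [br_X_zero, br_X_one _ (B.br (X 2) (X 0)), br_X_two _ (B.br (X 0) (X 1))] at hJ
  rw [modular_X_zero, modular_X_one, modular_X_two]
  linear_combination hJ

/-- The cubic form `x · w` is a semi-invariant whose log-ozone derivation is `-φ`: in
`-w × ∇(x · w) = -w × (x × curl w)` the triple product expands to `(x · w) curl w` because
`w · curl w = 0`. -/
theorem br_X_cubic (h : B.IsGraded) (i : Fin 3) :
    B.br (X i) B.cubic = B.cubic * -B.modular (X i) := by
  obtain ⟨d0, d1, d2⟩ := B.pderiv_cubic h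
  have hJ := B.br_dot_modular
  fin_cases i
  · change B.br (X 0) _ = _ * -B.modular (X 0)
    rw [br_X_zero, d1, d2, cubic]
    linear_combination X 0 * hJ
  · change B.br (X 1) _ = _ * -B.modular (X 1)
    rw [br_X_one, d0, d2, cubic]
    linear_combination X 1 * hJ
  · change B.br (X 2) _ = _ * -B.modular (X 2)
    rw [br_X_two, d0, d1, cubic]
    linear_combination X 2 * hJ

/-- If `x · w = 0`, then `3 w = -x × curl w`, so the bracket is determined by the modular derivation,
and every cubic form killed by `φ` has log-ozone derivation `-φ`. -/
theorem br_X_of_cubic_eq_zero (h : B.IsGraded) (h3 : (3 : k) ≠ 0) (h0 : B.cubic = 0)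
    {f : MvPolynomial (Fin 3) k} (hf : f.IsHomogeneous 3) (hm : B.modular f = 0) (i : Fin 3) :
    B.br (X i) f = f * -B.modular (X i) := by
  obtain ⟨d0, d1, d2⟩ := B.pderiv_cubic h
  rw [h0, map_zero] at d0 d1 d2
  have e := euler_three hf
  simp only [nsmul_eq_mul, Nat.cast_ofNat] at e
  rw [derivation_eq_sum_pderiv, Fin.sum_univ_three] at hm
  have h3' : (3 : MvPolynomial (Fin 3) k) ≠ 0 := fun h =>
    h3 (C_injective (Fin 3) k (by rw [map_ofNat, map_zero, h]))
  apply mul_left_cancel₀ h3'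
  fin_cases i
  · change 3 * B.br (X 0) _ = 3 * (_ * -B.modular (X 0))
    rw [br_X_zero]
    linear_combination pderiv 2 f * d1 - pderiv 1 f * d2 - B.modular (X 0) * e + X 0 * hm
  · change 3 * B.br (X 1) _ = 3 * (_ * -B.modular (X 1))
    rw [br_X_one]
    linear_combination pderiv 0 f * d2 - pderiv 2 f * d0 - B.modular (X 1) * e + X 1 * hm
  · change 3 * B.br (X 2) _ = 3 * (_ * -B.modular (X 2))
    rw [br_X_two]
    linear_combination pderiv 1 f * d0 - pderiv 0 f * d1 - B.modular (X 2) * e + X 2 * hm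

theorem pderiv_comm {R σ : Type*} [CommRing R] (i j : σ) (f : MvPolynomial σ R) :
    pderiv i (pderiv j f) = pderiv j (pderiv i f) := by
  classical
  have h : ⁅pderiv (R := R) i, pderiv (R := R) j⁆ = 0 := by
    refine MvPolynomial.derivation_ext fun l => ?_
    rw [Derivation.commutator_apply]
    simp only [pderiv_X, Pi.single_apply, Derivation.coe_zero, Pi.zero_apply]
    split_ifs <;> simp
  simpa [Derivation.commutator_apply, sub_eq_zero] using congrArg (fun D => D f) h

/-- The modular derivation has divergence zero, being a curl. -/
theorem sum_pderiv_modular_X : ∑ i, pderiv i (B.modular (X i)) = 0 := by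
  rw [Fin.sum_univ_three, modular_X_zero, modular_X_one, modular_X_two]
  simp only [map_sub]
  rw [pderiv_comm 1 0, pderiv_comm 2 0, pderiv_comm 2 1]
  ring

theorem isHomogeneous_modular_X (h : B.IsGraded) (i : Fin 3) :
    (B.modular (X i)).IsHomogeneous 1 := by
  rw [modular_apply]
  exact IsHomogeneous.sum _ _ _ fun j _ => (B.isHomogeneous_br_X h j i).pderiv

end ThreeVariables

/-! ### Invariants of traceless linear derivations -/

section Invariant

theorem eq_sum_of_isHomogeneous_one {k : Type*} [Field k] {n : ℕ} {f : MvPolynomial (Fin n) k}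
    (h : f.IsHomogeneous 1) : f = ∑ j, C (coeff 0 (pderiv j f)) * X j := by
  conv_lhs => rw [← one_nsmul f, ← h.sum_X_mul_pderiv]
  refine Finset.sum_congr rfl fun j _ => ?_
  have h0 : (pderiv j f).IsHomogeneous 0 := h.pderiv
  rw [mul_comm]
  congr 1
  exact totalDegree_eq_zero_iff_eq_C.1 ((totalDegree_zero_iff_isHomogeneous _).2 h0)

/-- Eigenvectors of the coefficient matrix are eigenforms of the corresponding linear derivation. -/
theorem exists_eigenform {K : Type*} [Field K] {n : ℕ} (A : Matrix (Fin n) (Fin n) K) {μ : K}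
    (hμ : A.charpoly.IsRoot μ) : ∃ l : MvPolynomial (Fin n) K, l ≠ 0 ∧ l.IsHomogeneous 1 ∧
      mkDerivation K (fun i => ∑ j, C (A i j) * X j) l = C μ * l := by
  classical
  rw [Polynomial.IsRoot, Matrix.eval_charpoly, ← Matrix.exists_vecMul_eq_zero_iff] at hμ
  obtain ⟨v, hv, hvA⟩ := hμ
  have hvA' : ∀ j, ∑ i, v i * A i j = μ * v j := fun j => by
    have h := congrFun hvA j
    rw [Matrix.vecMul_sub, Pi.sub_apply, Matrix.scalar_apply, Matrix.vecMul_diagonal,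
      Pi.zero_apply, sub_eq_zero] at h
    rw [mul_comm μ, h]
    rfl
  refine ⟨∑ i, C (v i) * X i, fun h0 => hv (funext fun i => ?_),
    IsHomogeneous.sum _ _ _ fun i _ => isHomogeneous_C_mul_X _ _, ?_⟩
  · have := congrArg (fun f => coeff 0 (pderiv i f)) h0
    simpa [pderiv_X, Pi.single_apply, apply_ite] using this
  · simp only [map_sum, Derivation.leibniz, derivation_C, mkDerivation_X, smul_eq_mul, mul_zero,
      add_zero, Finset.mul_sum]
    rw [Finset.sum_comm]
    refine Finset.sum_congr rfl fun j _ => ?_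
    rw [← mul_assoc, ← C_mul, ← hvA' j, map_sum, Finset.sum_mul]
    exact Finset.sum_congr rfl fun i _ => by rw [C_mul, mul_assoc]

/-- Multiplying eigenforms adds their eigenvalues. -/
theorem exists_semiinvariant {K : Type*} [Field K] {n : ℕ}
    (D : Derivation K (MvPolynomial (Fin n) K) (MvPolynomial (Fin n) K)) (s : Multiset K)
    (hs : ∀ μ ∈ s, ∃ l : MvPolynomial (Fin n) K, l ≠ 0 ∧ l.IsHomogeneous 1 ∧ D l = C μ * l) :
    ∃ f : MvPolynomial (Fin n) K, f ≠ 0 ∧ f.IsHomogeneous s.card ∧ D f = C s.sum * f := by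
  induction s using Multiset.induction with
  | empty => exact ⟨1, one_ne_zero, isHomogeneous_one _ _, by simp⟩
  | cons μ s ih =>
    obtain ⟨l, hl, hl1, hlD⟩ := hs μ (Multiset.mem_cons_self μ s)
    obtain ⟨f, hf, hfs, hfD⟩ := ih fun ν hν => hs ν (Multiset.mem_cons_of_mem hν)
    refine ⟨f * l, mul_ne_zero hf hl, ?_, ?_⟩
    · rw [Multiset.card_cons]
      exact hfs.mul hl1
    · rw [Derivation.leibniz, hlD, hfD, Multiset.sum_cons, C_add, smul_eq_mul, smul_eq_mul]
      ring

/-- Applying a `k`-linear functional `K → k` to the coefficients commutes with a derivation defined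
over `k`. -/
theorem map_mkDerivation_map {k K : Type*} [Field k] [Field K] [Algebra k K] {n : ℕ}
    (ℓ : K →ₗ[k] k) (D : Derivation k (MvPolynomial (Fin n) k) (MvPolynomial (Fin n) k))
    (F : MvPolynomial (Fin n) K) :
    AddMonoidAlgebra.map ℓ.toAddMonoidHom
      (mkDerivation K (fun i => map (algebraMap k K) (D (X i))) F) =
    D (AddMonoidAlgebra.map ℓ.toAddMonoidHom F) := by
  have hmap : ∀ g : MvPolynomial (Fin n) k,
      mkDerivation K (fun i => map (algebraMap k K) (D (X i))) (map (algebraMap k K) g) =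
        map (algebraMap k K) (D g) := by
    intro g
    induction g using MvPolynomial.induction_on with
    | C r => simp
    | add p q hp hq => simp only [map_add, hp, hq]
    | mul_X p i hp =>
      simp only [map_mul, Derivation.leibniz, hp, map_X, mkDerivation_X, smul_eq_mul, map_add]
  have hℓ : ∀ (c : K) (g : MvPolynomial (Fin n) k),
      AddMonoidAlgebra.map ℓ.toAddMonoidHom (C c * map (algebraMap k K) g) = C (ℓ c) * g := by
    intro c g
    ext m
    change ℓ (coeff m (C c * map (algebraMap k K) g)) = _
    rw [coeff_C_mul, coeff_map, coeff_C_mul, mul_comm, ← Algebra.smul_def, map_smul, smul_eq_mul,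
      mul_comm]
  induction F using MvPolynomial.induction_on' with
  | monomial m c =>
    have : monomial m c = C c * map (algebraMap k K) (monomial m 1) := by
      rw [map_monomial, map_one, C_mul_monomial, mul_one]
    rw [this, hℓ, Derivation.leibniz, derivation_C, smul_zero, add_zero, smul_eq_mul, hmap, hℓ,
      Derivation.leibniz, derivation_C, smul_zero, add_zero, smul_eq_mul]
  | add p q hp hq =>
    rw [map_add, AddMonoidAlgebra.map_add, hp, hq, AddMonoidAlgebra.map_add, map_add]

/-- A linear derivation of trace zero in `n` variables kills a nonzero form of degree `n`: over the
algebraic closure, take the product of one eigenform for each root of the characteristic polynomial,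
counted with multiplicity. Its eigenvalue is the trace. A linear functional applied to the
coefficients brings the form back to `k`. -/
theorem exists_invariant {k : Type*} [Field k] {n : ℕ}
    (D : Derivation k (MvPolynomial (Fin n) k) (MvPolynomial (Fin n) k))
    (hD : ∀ i, (D (X i)).IsHomogeneous 1) (htr : ∑ i, pderiv i (D (X i)) = 0) :
    ∃ f : MvPolynomial (Fin n) k, f ≠ 0 ∧ f.IsHomogeneous n ∧ D f = 0 := by
  let K := AlgebraicClosure k
  let A : Matrix (Fin n) (Fin n) K :=
    Matrix.of fun i j => algebraMap k K (coeff 0 (pderiv j (D (X i))))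
  have hDK : (fun i => map (algebraMap k K) (D (X i))) = fun i => ∑ j, C (A i j) * X j := by
    funext i
    conv_lhs => rw [eq_sum_of_isHomogeneous_one (hD i)]
    simp [A]
  have hA : A.charpoly.roots.sum = 0 := by
    rw [← Matrix.trace_eq_sum_roots_charpoly]
    simp only [Matrix.trace, Matrix.diag_apply, A, Matrix.of_apply]
    rw [← map_sum, ← coeff_sum, htr, coeff_zero, map_zero]
  have hcard : A.charpoly.roots.card = n := by
    rw [IsAlgClosed.card_roots_eq_natDegree, Matrix.charpoly_natDegree_eq_dim, Fintype.card_fin]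
  obtain ⟨F, hF, hFn, hFD⟩ := exists_semiinvariant
    (mkDerivation K fun i => map (algebraMap k K) (D (X i))) A.charpoly.roots fun μ hμ => by
      rw [hDK]
      exact exists_eigenform A (Polynomial.isRoot_of_mem_roots hμ)
  rw [hA, map_zero, zero_mul] at hFD
  rw [hcard] at hFn
  obtain ⟨m, hm⟩ := ne_zero_iff.1 hF
  obtain ⟨ℓ, hℓ⟩ : ∃ ℓ : K →ₗ[k] k, ℓ (coeff m F) ≠ 0 := by
    by_contra! h
    exact hm ((Module.forall_dual_apply_eq_zero_iff k _).1 h)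
  have hc : ∀ d, coeff d (AddMonoidAlgebra.map ℓ.toAddMonoidHom F : MvPolynomial (Fin n) k) =
    ℓ (coeff d F) := fun d => rfl
  refine ⟨AddMonoidAlgebra.map ℓ.toAddMonoidHom F, ne_zero_iff.2 ⟨m, by rwa [hc]⟩, ?_, ?_⟩
  · intro d hd
    refine hFn fun h0 => hd ?_
    rw [hc, h0, map_zero]
  · rw [← map_mkDerivation_map, hFD, AddMonoidAlgebra.map_zero]

end Invariant

/-! ### The modular derivation and potentials -/

section Modular

variable {k : Type*} [Field k]

/-- The modular derivation always belongs to the log-ozone group. -/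
theorem modular_mem_loz (p : ℕ) [CharP k p] (hp : 3 < p)
    (B : PoissonBracket k (MvPolynomial (Fin 3) k)) (h : B.IsGraded) : B.modular ∈ B.loz := by
  have h3 : (3 : k) ≠ 0 := by
    exact_mod_cast natCast_ne_zero_of_lt (k := k) p (n := 3) (by norm_num) hp
  obtain ⟨f, hf, hfX⟩ : ∃ f : MvPolynomial (Fin 3) k, f ≠ 0 ∧
      ∀ i, B.br (X i) f = f * -B.modular (X i) := by
    by_cases h0 : B.cubic = 0
    · obtain ⟨f, hf, hf3, hfm⟩ := exists_invariant B.modular (B.isHomogeneous_modular_X h)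
        B.sum_pderiv_modular_X
      exact ⟨f, hf, B.br_X_of_cubic_eq_zero h h3 h0 hf3 hfm⟩
    · exact ⟨B.cubic, h0, B.br_X_cubic h⟩
  -- The power `p - 1` turns `-φ` into `φ`.
  rw [mem_loz_iff]
  refine ⟨f ^ (p - 1), pow_ne_zero _ hf, B.br_eq_mul_of_X _ fun i => ?_⟩
  rw [B.br_pow_of_br_eq_mul (hfX i), Nat.cast_sub (by omega), CharP.cast_eq_zero]
  simp

theorem isomorphic_ofPotential_cubic (hk : (3 : k) ≠ 0)
    (B : PoissonBracket k (MvPolynomial (Fin 3) k)) (h : B.IsGraded) (hu : B.IsUnimodular) :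
    B.Isomorphic (ofPotential (C 3⁻¹ * B.cubic)) := by
  obtain ⟨d0, d1, d2⟩ := B.pderiv_cubic h
  obtain ⟨o2, o0, o1⟩ := ofPotential_X (C 3⁻¹ * B.cubic)
  have hu' : ∀ a, B.modular a = 0 := fun a => by rw [hu]; rfl
  have h3 := C_inv_three_mul (k := k) hk
  simp only [pderiv_C_mul, d0, d1, d2, hu', mul_zero, sub_zero, add_zero, ← mul_assoc, h3,
    one_mul] at o0 o1 o2
  refine B.isomorphic_of_X _ AlgEquiv.refl fun i j => ?_
  rw [AlgEquiv.coe_refl, id_eq, id_eq, id_eq]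
  fin_cases i
  · change B.br (X 0) _ = (ofPotential _).br (X 0) _
    rw [br_X_zero, br_X_zero (ofPotential _), o1, o2]
  · change B.br (X 1) _ = (ofPotential _).br (X 1) _
    rw [br_X_one, br_X_one (ofPotential _), o0, o2]
  · change B.br (X 2) _ = (ofPotential _).br (X 2) _
    rw [br_X_two, br_X_two (ofPotential _), o0, o1]

end Modular

/-! ### Degrees, top components and factorizations -/

section Degree

variable {R σ : Type*}

theorem homogeneousComponent_mul_of_totalDegree_le [CommSemiring R] {f g : MvPolynomial σ R}
    {m n : ℕ} (hf : f.totalDegree ≤ m) (hg : g.totalDegree ≤ n) :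
    homogeneousComponent (m + n) (f * g) = homogeneousComponent m f * homogeneousComponent n g := by
  classical
  have hz : ∀ {h : MvPolynomial σ R} {r : ℕ} {d : σ →₀ ℕ}, h.totalDegree ≤ r → r < d.degree →
      coeff d h = 0 := fun hr hd => coeff_eq_zero_of_totalDegree_lt (lt_of_le_of_lt hr hd)
  ext d
  rw [coeff_homogeneousComponent]
  split_ifs with hd
  · rw [coeff_mul, coeff_mul]
    refine Finset.sum_congr rfl fun x hx => ?_
    rw [Finset.HasAntidiagonal.mem_antidiagonal] at hx
    have hdeg : x.1.degree + x.2.degree = m + n := by rw [← map_add, hx, hd]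
    rw [coeff_homogeneousComponent, coeff_homogeneousComponent]
    rcases lt_trichotomy x.1.degree m with h | h | h
    · rw [hz hg (show n < x.2.degree by omega)]
      simp
    · rw [if_pos h, if_pos (by omega)]
    · rw [hz hf h]
      simp
  · exact (((homogeneousComponent_isHomogeneous m f).mul
      (homogeneousComponent_isHomogeneous n g)).coeff_eq_zero hd).symm

theorem homogeneousComponent_totalDegree_ne_zero [CommSemiring R] {f : MvPolynomial σ R}
    (hf : f ≠ 0) : homogeneousComponent f.totalDegree f ≠ 0 := by
  intro h
  obtain ⟨d, hd, hdeg⟩ := Finset.exists_mem_eq_sup f.support (support_nonempty.2 hf)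
    (fun s => s.sum fun _ e => e)
  refine mem_support_iff.1 hd ?_
  have := congrArg (coeff d) h
  rwa [coeff_homogeneousComponent, if_pos (show d.degree = f.totalDegree from hdeg.symm)] at this

/-- In positive characteristic this does not force `f` to be free of the `i`-th variable, as `f` may
be a polynomial in its `p`-th power. -/
theorem pderiv_eq_zero_of_dvd [CommRing R] [IsDomain R] {f : MvPolynomial σ R} {i : σ}
    (h : f ∣ pderiv i f) : pderiv i f = 0 := by
  by_contra h0
  have hle : f.totalDegree ≤ (pderiv i f).totalDegree := by
    obtain ⟨g, hg⟩ := h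
    rw [hg] at h0 ⊢
    rw [totalDegree_mul_of_isDomain (left_ne_zero_of_mul h0) (right_ne_zero_of_mul h0)]
    exact Nat.le_add_right _ _
  obtain ⟨d, hd, hdeg⟩ := Finset.exists_mem_eq_sup _ (support_nonempty.2 h0)
    (fun s => s.sum fun _ e => e)
  rw [mem_support_iff, coeff_pderiv] at hd
  have h1 := le_totalDegree (mem_support_iff.2 (left_ne_zero_of_mul hd))
  have h2 : (pderiv i f).totalDegree = d.degree := hdeg
  change (d + Finsupp.single i 1).degree ≤ _ at h1
  rw [map_add, Finsupp.degree_single] at h1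
  omega

/-- The factors of a factorization need not be assumed homogeneous: their top components multiply to
`Ω`. -/
theorem exists_eq_mul_of_not_irreducible {k : Type*} [Field k] {Ω : MvPolynomial σ k}
    (hΩ : Ω.IsHomogeneous 3) (h0 : Ω ≠ 0) (hirr : ¬ Irreducible Ω) :
    ∃ l q : MvPolynomial σ k, l.IsHomogeneous 1 ∧ q.IsHomogeneous 2 ∧ Ω = l * q := by
  have hdeg : ∀ a : MvPolynomial σ k, a ≠ 0 → ¬ IsUnit a → 1 ≤ a.totalDegree := by
    intro a ha hu
    by_contra! h
    have hC := totalDegree_eq_zero_iff_eq_C.1 (Nat.lt_one_iff.1 h)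
    rw [hC] at ha hu
    exact hu ((isUnit_iff_ne_zero.2 fun h => ha (by rw [h, C_0])).map C)
  have hu : ¬ IsUnit Ω := fun hu => by
    obtain ⟨b, hb⟩ := hu.exists_right_inv
    have hb0 : b ≠ 0 := by rintro rfl; simp at hb
    have := totalDegree_mul_of_isDomain h0 hb0
    rw [hb, hΩ.totalDegree h0, totalDegree_one] at this
    omega
  rw [irreducible_iff] at hirr
  push Not at hirr
  obtain ⟨a, b, hab, ha, hb⟩ := hirr hu
  have ha0 : a ≠ 0 := by rintro rfl; simp [hab] at h0
  have hb0 : b ≠ 0 := by rintro rfl; simp [hab] at h0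
  have hsum : a.totalDegree + b.totalDegree = 3 := by
    rw [← totalDegree_mul_of_isDomain ha0 hb0, ← hab, hΩ.totalDegree h0]
  have hΩ' := homogeneousComponent_eq_self hΩ
  rw [← hsum] at hΩ'
  nth_rw 1 [hab] at hΩ'
  rw [homogeneousComponent_mul_of_totalDegree_le le_rfl le_rfl] at hΩ'
  have ha1 := hdeg a ha0 ha
  have hb1 := hdeg b hb0 hb
  obtain h | h : a.totalDegree = 1 ∧ b.totalDegree = 2 ∨ a.totalDegree = 2 ∧ b.totalDegree = 1 := by
    omega
  · rw [h.1, h.2] at hΩ'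
    exact ⟨_, _, homogeneousComponent_isHomogeneous _ _, homogeneousComponent_isHomogeneous _ _,
      hΩ'.symm⟩
  · rw [h.1, h.2, mul_comm] at hΩ'
    exact ⟨_, _, homogeneousComponent_isHomogeneous _ _, homogeneousComponent_isHomogeneous _ _,
      hΩ'.symm⟩

/-- If `f` divides `π ^ (r + 1) * ∂ᵢ f`, then the part `g` of `f` prime to `π` divides `∂ᵢ g`, which
has smaller degree and hence vanishes. -/
theorem exists_eq_pow_mul_of_dvd_pderiv {k : Type*} [Field k] {n : ℕ}
    {π f : MvPolynomial (Fin n) k} (hπ : Irreducible π) (hf : f ≠ 0) (r : ℕ) {S : Set (Fin n)}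
    (h : ∀ i ∈ S, f ∣ π ^ (r + 1) * pderiv i f) :
    ∃ m g, f = π ^ m * g ∧ ∀ i ∈ S, pderiv i g = 0 := by
  obtain ⟨m, g, hg, hfg⟩ := WfDvdMonoid.max_power_factor hf hπ
  refine ⟨m, g, hfg, fun i hi => pderiv_eq_zero_of_dvd ?_⟩
  have hm : π ^ m ≠ 0 := pow_ne_zero _ hπ.ne_zero
  have hrel : IsRelPrime g (π ^ (r + 1)) := ((hπ.isRelPrime_iff_not_dvd.2 hg).pow_left).symm
  refine hrel.dvd_of_dvd_mul_left ((mul_dvd_mul_iff_left hm).1 ?_)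
  have h1 := h i hi
  have h2 : π ^ m * g ∣ π ^ (r + 1) * (g * pderiv i (π ^ m)) := by
    cases m with
    | zero => simp
    | succ m =>
      refine ⟨(m + 1 : ℕ) * π ^ r * pderiv i π, ?_⟩
      rw [Derivation.leibniz_pow, nsmul_eq_mul, smul_eq_mul, Nat.add_sub_cancel]
      ring
  rw [hfg, Derivation.leibniz, smul_eq_mul, smul_eq_mul, mul_add] at h1
  have h3 := (dvd_add_left h2).1 h1
  rwa [mul_left_comm] at h3

end Degree

/-! ### Homogeneous normal elements -/

section Graded

variable {k : Type*} [Field k]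

theorem isHomogeneous_mul_pderiv {n : ℕ} {w f : MvPolynomial (Fin 3) k} (hw : w.IsHomogeneous 2)
    (hf : f.IsHomogeneous n) (i : Fin 3) : (w * pderiv i f).IsHomogeneous (n + 1) := by
  cases n with
  | zero =>
    rw [totalDegree_eq_zero_iff_eq_C.1 ((totalDegree_zero_iff_isHomogeneous _).2 hf), pderiv_C,
      mul_zero]
    exact isHomogeneous_zero _ _ _
  | succ n => rw [show n + 1 + 1 = 2 + n by omega]; exact hw.mul hf.pderiv

theorem isHomogeneous_br_X_ofPotential {Ω : MvPolynomial (Fin 3) k} (hΩ : Ω.IsHomogeneous 3)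
    {n : ℕ} {f : MvPolynomial (Fin 3) k} (hf : f.IsHomogeneous n) (i : Fin 3) :
    ((ofPotential Ω).br (X i) f).IsHomogeneous (n + 1) := by
  obtain ⟨o2, o0, o1⟩ := ofPotential_X Ω
  have hw : ∀ j, (pderiv j Ω).IsHomogeneous 2 := fun j => hΩ.pderiv
  fin_cases i
  · change ((ofPotential Ω).br (X 0) f).IsHomogeneous (n + 1)
    rw [br_X_zero, o1, o2]
    exact (isHomogeneous_mul_pderiv (hw _) hf _).sub (isHomogeneous_mul_pderiv (hw _) hf _)
  · change ((ofPotential Ω).br (X 1) f).IsHomogeneous (n + 1)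
    rw [br_X_one, o0, o2]
    exact (isHomogeneous_mul_pderiv (hw _) hf _).sub (isHomogeneous_mul_pderiv (hw _) hf _)
  · change ((ofPotential Ω).br (X 2) f).IsHomogeneous (n + 1)
    rw [br_X_two, o0, o1]
    exact (isHomogeneous_mul_pderiv (hw _) hf _).sub (isHomogeneous_mul_pderiv (hw _) hf _)

variable {n : ℕ} (B : PoissonBracket k (MvPolynomial (Fin n) k))

theorem isNormal_of_X {f : MvPolynomial (Fin n) k} (h : ∀ i, f ∣ B.br (X i) f) : B.IsNormal f := by
  intro a
  rw [← B.sum_pderiv_mul_br]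
  exact Finset.dvd_sum fun i _ => (h i).mul_left _

theorem br_eq_zero_of_X {f : MvPolynomial (Fin n) k} (h : ∀ i, B.br (X i) f = 0)
    (a : MvPolynomial (Fin n) k) : B.br a f = 0 := by
  rw [← B.sum_pderiv_mul_br]
  exact Finset.sum_eq_zero fun i _ => by rw [h, mul_zero]

/-- Reduction to homogeneous normal elements. If `{xᵢ, f} = f vᵢ`, then `vᵢ` has degree at most `1`, and
the top component of `f` is normal with log-ozone values the linear parts of the `vᵢ`. If these
vanish, `vᵢ` is a constant, and comparing components upwards from degree `0` shows that it is `0`. -/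
theorem loz_eq_zero_of_homogeneous
    (hB : ∀ i d (f : MvPolynomial (Fin n) k), f.IsHomogeneous d →
      (B.br (X i) f).IsHomogeneous (d + 1))
    (H : ∀ d (f : MvPolynomial (Fin n) k), f.IsHomogeneous d → B.IsNormal f →
      ∀ i, B.br (X i) f = 0) : B.loz = {0} := by
  rw [loz_eq_zero_iff]
  intro f hn
  by_cases hf : f = 0
  · simp [hf]
  refine B.br_eq_zero_of_X ?_
  choose v hv using fun i => hn (X i)
  set D := f.totalDegree with hD
  have hsum : ∀ i, B.br (X i) f =
      ∑ d ∈ Finset.range (D + 1), B.br (X i) (homogeneousComponent d f) := fun i => by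
    rw [← map_sum, hD, sum_homogeneousComponent]
  have hhom : ∀ i d, (B.br (X i) (homogeneousComponent d f)).IsHomogeneous (d + 1) := fun i d =>
    hB i d _ (homogeneousComponent_isHomogeneous d f)
  have hcomp : ∀ i d, homogeneousComponent (d + 1) (B.br (X i) f) =
      B.br (X i) (homogeneousComponent d f) := by
    intro i d
    rw [hsum, map_sum, Finset.sum_congr rfl fun e _ => homogeneousComponent_of_mem (hhom i e)]
    simp only [Nat.add_right_cancel_iff, Finset.sum_ite_eq, Finset.mem_range]
    split_ifs with h
    · rfl
    · rw [homogeneousComponent_eq_zero _ _ (by omega), map_zero]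
  have hcomp0 : ∀ i, homogeneousComponent 0 (B.br (X i) f) = 0 := by
    intro i
    rw [hsum, map_sum, Finset.sum_congr rfl fun e _ => homogeneousComponent_of_mem (hhom i e)]
    simp
  have hdeg : ∀ i, (v i).totalDegree ≤ 1 := by
    intro i
    by_cases hvi : v i = 0
    · simp [hvi]
    have h1 : (B.br (X i) f).totalDegree ≤ D + 1 := by
      rw [hsum]
      refine totalDegree_finsetSum_le fun d hd => (hhom i d).totalDegree_le.trans ?_
      rw [Finset.mem_range] at hd
      omega
    rw [hv, totalDegree_mul_of_isDomain hf hvi] at h1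
    omega
  have htop : ∀ i, B.br (X i) (homogeneousComponent D f) =
      homogeneousComponent D f * homogeneousComponent 1 (v i) := fun i => by
    rw [← hcomp, hv, homogeneousComponent_mul_of_totalDegree_le le_rfl (hdeg i)]
  have hzero := H D _ (homogeneousComponent_isHomogeneous D f)
    (B.isNormal_of_X fun i => ⟨_, htop i⟩)
  intro i
  have hv1 : homogeneousComponent 1 (v i) = 0 := by
    have := htop i
    rw [hzero, eq_comm, mul_eq_zero] at this
    exact this.resolve_left (homogeneousComponent_totalDegree_ne_zero hf)
  obtain ⟨c, hc⟩ : ∃ c, v i = C c := by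
    have h0 : (v i).totalDegree ≠ 1 := fun h => by
      refine homogeneousComponent_totalDegree_ne_zero (f := v i) (fun h0 => ?_) (by rw [h, hv1])
      simp [h0] at h
    have := hdeg i
    exact ⟨_, totalDegree_eq_zero_iff_eq_C.1 (by omega)⟩
  rw [hv, hc]
  by_contra hne
  have hc0 : (C c : MvPolynomial (Fin n) k) ≠ 0 := right_ne_zero_of_mul hne
  have hall : ∀ d, homogeneousComponent d f = 0 := by
    intro d
    induction d with
    | zero =>
      have := hcomp0 i
      rw [hv, hc, mul_comm, homogeneousComponent_C_mul, mul_eq_zero] at this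
      exact this.resolve_left hc0
    | succ d ih =>
      have := hcomp i d
      rw [hv, hc, mul_comm, homogeneousComponent_C_mul, ih, map_zero, mul_eq_zero] at this
      exact this.resolve_left hc0
  exact homogeneousComponent_totalDegree_ne_zero hf (hall _)

end Graded

/-! ### Potentials with trivial log-ozone group -/

section Potentials

variable {k : Type*} [Field k]

/-- Normality of a form `f` of degree `d` says that `f` divides `∇f × ∇Ω`. Taking the cross product with
`x` and using Euler's identity, `f` divides `3 Ω ∇f - d f ∇Ω`, hence `Ω ∇f`. So `f` is a power of `Ω`
times a polynomial with zero gradient, and both factors are central. -/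
theorem loz_ofPotential_of_irreducible (h3 : (3 : k) ≠ 0) {Ω : MvPolynomial (Fin 3) k}
    (hΩ : Ω.IsHomogeneous 3) (hirr : Irreducible Ω) : (ofPotential Ω).loz = {0} := by
  refine loz_eq_zero_of_homogeneous _ (fun i d f hf => isHomogeneous_br_X_ofPotential hΩ hf i) ?_
  intro d f hf hn
  obtain ⟨o2, o0, o1⟩ := ofPotential_X Ω
  by_cases hf0 : f = 0
  · simp [hf0]
  have e := euler_three hf
  have eΩ := euler_three hΩ
  rw [nsmul_eq_mul] at e eΩ
  have n0 := hn (X 0)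
  have n1 := hn (X 1)
  have n2 := hn (X 2)
  rw [br_X_zero, o1, o2] at n0
  rw [br_X_one, o0, o2] at n1
  rw [br_X_two, o0, o1] at n2
  have hu := C_inv_three_mul (k := k) h3
  push_cast at eΩ
  have hdvd : ∀ i ∈ (Set.univ : Set (Fin 3)), f ∣ Ω ^ (0 + 1) * pderiv i f := by
    intro i _
    obtain ⟨v0, hv0⟩ := n0
    obtain ⟨v1, hv1⟩ := n1
    obtain ⟨v2, hv2⟩ := n2
    fin_cases i
    · change f ∣ Ω ^ (0 + 1) * pderiv 0 f
      exact ⟨C 3⁻¹ * ((d : MvPolynomial (Fin 3) k) * pderiv 0 Ω + X 1 * v2 - X 2 * v1), by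
        linear_combination C 3⁻¹ * (pderiv 0 Ω * e - pderiv 0 f * eΩ + X 1 * hv2 - X 2 * hv1)
          - Ω * pderiv 0 f * hu⟩
    · change f ∣ Ω ^ (0 + 1) * pderiv 1 f
      exact ⟨C 3⁻¹ * ((d : MvPolynomial (Fin 3) k) * pderiv 1 Ω + X 2 * v0 - X 0 * v2), by
        linear_combination C 3⁻¹ * (pderiv 1 Ω * e - pderiv 1 f * eΩ + X 2 * hv0 - X 0 * hv2)
          - Ω * pderiv 1 f * hu⟩
    · change f ∣ Ω ^ (0 + 1) * pderiv 2 f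
      exact ⟨C 3⁻¹ * ((d : MvPolynomial (Fin 3) k) * pderiv 2 Ω + X 0 * v1 - X 1 * v0), by
        linear_combination C 3⁻¹ * (pderiv 2 Ω * e - pderiv 2 f * eΩ + X 0 * hv1 - X 1 * hv0)
          - Ω * pderiv 2 f * hu⟩
  obtain ⟨m, g, hfg, hg⟩ := exists_eq_pow_mul_of_dvd_pderiv hirr hf0 0 hdvd
  have hgB : ∀ a, (ofPotential Ω).br a g = 0 := fun a => by
    rw [br_skew, ← sum_pderiv_mul_br]
    simp [fun i => hg i (Set.mem_univ i)]
  have hΩB : ∀ i, (ofPotential Ω).br (X i) Ω = Ω * 0 := by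
    intro i
    rw [mul_zero]
    simp only [ofPotential, LinearMap.mk₂_apply]
    ring
  intro i
  rw [hfg, br_mul, hgB, br_pow_of_br_eq_mul _ (hΩB i)]
  ring

theorem loz_ofPotential_X_pow (h3 : (3 : k) ≠ 0) :
    (ofPotential (X 0 ^ 3 : MvPolynomial (Fin 3) k)).loz = {0} := by
  rw [loz_eq_zero_iff]
  intro f hn
  obtain ⟨o2, o0, o1⟩ := ofPotential_X (X 0 ^ 3 : MvPolynomial (Fin 3) k)
  by_cases hf0 : f = 0
  · simp [hf0]
  simp only [pderiv_pow, pderiv_X_self, pderiv_X_of_ne (show (0 : Fin 3) ≠ 1 by decide),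
    pderiv_X_of_ne (show (0 : Fin 3) ≠ 2 by decide), mul_zero, mul_one, Nat.cast_ofNat,
    Nat.add_one_sub_one] at o0 o1 o2
  have n1 := hn (X 1)
  have n2 := hn (X 2)
  rw [br_X_one, o0, o2] at n1
  rw [br_X_two, o0, o1] at n2
  have hu := C_inv_three_mul (k := k) h3
  obtain ⟨v1, hv1⟩ := n1
  obtain ⟨v2, hv2⟩ := n2
  have hdvd : ∀ i ∈ ({1, 2} : Set (Fin 3)), f ∣ X 0 ^ (1 + 1) * pderiv i f := by
    rintro i (rfl | rfl)
    · exact ⟨-C 3⁻¹ * v2, by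
        linear_combination -C 3⁻¹ * hv2 - X 0 ^ 2 * pderiv 1 f * hu⟩
    · exact ⟨C 3⁻¹ * v1, by
        linear_combination C 3⁻¹ * hv1 - X 0 ^ 2 * pderiv 2 f * hu⟩
  obtain ⟨m, g, hfg, hg⟩ := exists_eq_pow_mul_of_dvd_pderiv
    (X_prime (R := k) (i := (0 : Fin 3))).irreducible hf0 1 hdvd
  have h1 : pderiv 1 f = 0 := by
    rw [hfg, pderiv_mul, pderiv_pow, hg 1 (by simp),
      pderiv_X_of_ne (show (0 : Fin 3) ≠ 1 by decide)]
    ring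
  have h2 : pderiv 2 f = 0 := by
    rw [hfg, pderiv_mul, pderiv_pow, hg 2 (by simp),
      pderiv_X_of_ne (show (0 : Fin 3) ≠ 2 by decide)]
    ring
  refine br_eq_zero_of_X _ fun i => ?_
  fin_cases i
  · change (ofPotential (X 0 ^ 3)).br (X 0) f = 0
    rw [br_X_zero, h1, h2]
    ring
  · change (ofPotential (X 0 ^ 3)).br (X 1) f = 0
    rw [br_X_one, o2, h2]
    ring
  · change (ofPotential (X 0 ^ 3)).br (X 2) f = 0
    rw [br_X_two, o1, h1]
    ring

end Potentials

/-! ### Linear changes of variables -/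

section LinearChange

variable {k : Type*} [Field k]

/-- The linear substitution `xᵢ ↦ ∑ⱼ Mᵢⱼ xⱼ`. -/
noncomputable def linearSubst {n : ℕ} (M : Matrix (Fin n) (Fin n) k) :
    MvPolynomial (Fin n) k →ₐ[k] MvPolynomial (Fin n) k :=
  aeval fun i => ∑ j, C (M i j) * X j

theorem linearSubst_X {n : ℕ} (M : Matrix (Fin n) (Fin n) k) (i : Fin n) :
    linearSubst M (X i) = ∑ j, C (M i j) * X j := by
  rw [linearSubst, aeval_X]

theorem linearSubst_comp {n : ℕ} {M N : Matrix (Fin n) (Fin n) k} (h : N * M = 1) :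
    (linearSubst M).comp (linearSubst N) = AlgHom.id k _ := by
  refine MvPolynomial.algHom_ext fun i => ?_
  rw [AlgHom.comp_apply, linearSubst_X, map_sum, AlgHom.id_apply]
  simp only [map_mul, linearSubst_X, ← algebraMap_eq, AlgHom.commutes, Finset.mul_sum]
  rw [Finset.sum_comm]
  simp only [← mul_assoc, ← map_mul, ← Finset.sum_mul, ← map_sum, ← Matrix.mul_apply, h]
  simp [Matrix.one_apply]

/-- The linear change of variables `xᵢ ↦ ∑ⱼ Mᵢⱼ xⱼ` for an invertible matrix `M`. -/
noncomputable def linearEquiv {n : ℕ} (M : Matrix (Fin n) (Fin n) k) (hM : IsUnit M.det) :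
    MvPolynomial (Fin n) k ≃ₐ[k] MvPolynomial (Fin n) k :=
  AlgEquiv.ofAlgHom (linearSubst M) (linearSubst M⁻¹)
    (linearSubst_comp (M.nonsing_inv_mul hM)) (linearSubst_comp (M.mul_nonsing_inv hM))

/-- A nonzero vector is the first row of a matrix of any prescribed determinant. -/
theorem exists_det_eq {a : Fin 3 → k} (ha : a ≠ 0) (d : k) :
    ∃ M : Matrix (Fin 3) (Fin 3) k, M 0 = a ∧ M.det = d := by
  obtain ⟨i, hi⟩ := Function.ne_iff.1 ha
  simp only [Pi.zero_apply] at hi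
  fin_cases i
  · refine ⟨!![a 0, a 1, a 2; 0, d / a 0, 0; 0, 0, 1], ?_, ?_⟩
    · ext j; fin_cases j <;> rfl
    · have hi' : a 0 ≠ 0 := hi
      rw [Matrix.det_fin_three]
      simp only [Matrix.of_apply, Matrix.cons_val]
      field_simp
      ring
  · refine ⟨!![a 0, a 1, a 2; 0, 0, d / a 1; 1, 0, 0], ?_, ?_⟩
    · ext j; fin_cases j <;> rfl
    · have hi' : a 1 ≠ 0 := hi
      rw [Matrix.det_fin_three]
      simp only [Matrix.of_apply, Matrix.cons_val]
      field_simp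
      ring
  · refine ⟨!![a 0, a 1, a 2; d / a 2, 0, 0; 0, 1, 0], ?_, ?_⟩
    · ext j; fin_cases j <;> rfl
    · have hi' : a 2 ≠ 0 := hi
      rw [Matrix.det_fin_three]
      simp only [Matrix.of_apply, Matrix.cons_val]
      field_simp
      ring

/-- Potentials transform by the determinant of a linear change of variables; choosing the change with
determinant `c⁻¹` absorbs the constant. -/
theorem ofPotential_cube_isomorphic {l : MvPolynomial (Fin 3) k} (hl : l.IsHomogeneous 1)
    (hl0 : l ≠ 0) {c : k} (hc : c ≠ 0) :
    (ofPotential (C c * l ^ 3)).Isomorphic (ofPotential (X 0 ^ 3 : MvPolynomial (Fin 3) k)) := by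
  suffices h : (ofPotential (X 0 ^ 3)).Isomorphic (ofPotential (C c * l ^ 3)) from h.symm
  have hsum := eq_sum_of_isHomogeneous_one hl
  set a : Fin 3 → k := fun j => coeff 0 (pderiv j l) with ha
  have ha0 : a ≠ 0 := fun h => hl0 (by
    rw [hsum]
    exact Finset.sum_eq_zero fun j _ => by rw [show coeff 0 (pderiv j l) = 0 from congrFun h j]; simp)
  obtain ⟨M, hMa, hMd⟩ := exists_det_eq ha0 c⁻¹
  have hMu : IsUnit M.det := by rw [hMd]; exact (inv_ne_zero hc).isUnit
  have hX : ∀ i, linearEquiv M hMu (X i) = ∑ j, C (M i j) * X j := linearSubst_X M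
  have hX0 : linearEquiv M hMu (X 0) = l := by rw [hX, hMa]; exact hsum.symm
  have hpd : ∀ i j, pderiv j (linearEquiv M hMu (X i)) = C (M i j) := fun i j => by
    simp [hX, pderiv_X, Pi.single_apply]
  have hpl : ∀ j, pderiv j l = C (M 0 j) := fun j => by rw [← hX0, hpd]
  have hdet : C c * (C (M 0 0) * C (M 1 1) * C (M 2 2) - C (M 0 0) * C (M 1 2) * C (M 2 1)
      - C (M 0 1) * C (M 1 0) * C (M 2 2) + C (M 0 1) * C (M 1 2) * C (M 2 0)
      + C (M 0 2) * C (M 1 0) * C (M 2 1) - C (M 0 2) * C (M 1 1) * C (M 2 0)) =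
      (1 : MvPolynomial (Fin 3) k) := by
    rw [Matrix.det_fin_three] at hMd
    simp only [← C_mul, ← C_sub, ← C_add]
    rw [hMd, mul_inv_cancel₀ hc, C_1]
  obtain ⟨o2, o0, o1⟩ := ofPotential_X (X 0 ^ 3 : MvPolynomial (Fin 3) k)
  simp only [pderiv_pow, pderiv_X_self, pderiv_X_of_ne (show (0 : Fin 3) ≠ 1 by decide),
    pderiv_X_of_ne (show (0 : Fin 3) ≠ 2 by decide), mul_zero, mul_one, Nat.cast_ofNat,
    Nat.add_one_sub_one] at o0 o1 o2
  have hbr : ∀ i j, (ofPotential (C c * l ^ 3)).br (linearEquiv M hMu (X i))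
      (linearEquiv M hMu (X j)) =
      C c * (3 * l ^ 2) * ((C (M i 0) * C (M j 1) - C (M i 1) * C (M j 0)) * C (M 0 2)
        + (C (M i 1) * C (M j 2) - C (M i 2) * C (M j 1)) * C (M 0 0)
        + (C (M i 2) * C (M j 0) - C (M i 0) * C (M j 2)) * C (M 0 1)) := by
    intro i j
    simp only [ofPotential, LinearMap.mk₂_apply, hpd, pderiv_C_mul, pderiv_pow, hpl]
    push_cast
    ring
  have h12 : linearEquiv M hMu ((ofPotential (X 0 ^ 3)).br (X 1) (X 2)) =
      (ofPotential (C c * l ^ 3)).br (linearEquiv M hMu (X 1)) (linearEquiv M hMu (X 2)) := by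
    rw [hbr, o0, map_mul, map_pow, hX0, map_ofNat]
    linear_combination -3 * l ^ 2 * hdet
  have h20 : linearEquiv M hMu ((ofPotential (X 0 ^ 3)).br (X 2) (X 0)) =
      (ofPotential (C c * l ^ 3)).br (linearEquiv M hMu (X 2)) (linearEquiv M hMu (X 0)) := by
    rw [hbr, o1, map_zero]
    ring
  have h01 : linearEquiv M hMu ((ofPotential (X 0 ^ 3)).br (X 0) (X 1)) =
      (ofPotential (C c * l ^ 3)).br (linearEquiv M hMu (X 0)) (linearEquiv M hMu (X 1)) := by
    rw [hbr, o2, map_zero]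
    ring
  have hskew : ∀ i j, linearEquiv M hMu ((ofPotential (X 0 ^ 3)).br (X i) (X j)) =
      (ofPotential (C c * l ^ 3)).br (linearEquiv M hMu (X i)) (linearEquiv M hMu (X j)) →
      linearEquiv M hMu ((ofPotential (X 0 ^ 3)).br (X j) (X i)) =
      (ofPotential (C c * l ^ 3)).br (linearEquiv M hMu (X j)) (linearEquiv M hMu (X i)) := by
    intro i j h
    rw [br_skew, map_neg, h, ← br_skew]
  refine isomorphic_of_X _ _ (linearEquiv M hMu) fun i j => ?_
  fin_cases i <;> fin_cases j
  · simp [br_self]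
  · exact h01
  · exact hskew _ _ h20
  · exact hskew _ _ h01
  · simp [br_self]
  · exact h12
  · exact h20
  · exact hskew _ _ h12
  · simp [br_self]

end LinearChange

/-! ### Reducible potentials -/

section Reducible

variable {k : Type*} [Field k]

/-- Contract the hypothesis with `x` and apply Euler's identity to `l` and `f`. -/
theorem parallel_gradient {σ : Type*} [Fintype σ] {n : ℕ} {l f : MvPolynomial σ k}
    (hl : l.IsHomogeneous 1) (hf : f.IsHomogeneous n)
    (h : ∀ i j, pderiv i l * pderiv j f = pderiv j l * pderiv i f) (i : σ) :
    pderiv i l * (n * f) = pderiv i f * l := by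
  rw [← nsmul_eq_mul, ← hf.sum_X_mul_pderiv]
  nth_rw 2 [← one_nsmul l]
  rw [← hl.sum_X_mul_pderiv, Finset.mul_sum, Finset.mul_sum]
  refine Finset.sum_congr rfl fun j _ => ?_
  linear_combination X j * h i j

theorem exists_eq_C_mul_pow_of_parallel {σ : Type*} [Fintype σ] {l q : MvPolynomial σ k}
    (h2 : (2 : k) ≠ 0) (hl0 : l ≠ 0) (hl : l.IsHomogeneous 1) (hq : q.IsHomogeneous 2)
    (h : ∀ i j, pderiv i l * pderiv j q = pderiv j l * pderiv i q) :
    ∃ c, q = C c * l ^ 2 := by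
  have hconst : ∀ {f : MvPolynomial σ k}, f.IsHomogeneous 1 → ∀ i, ∃ c, pderiv i f = C c :=
    fun hf i => ⟨_, totalDegree_eq_zero_iff_eq_C.1
      ((totalDegree_zero_iff_isHomogeneous _).2 hf.pderiv)⟩
  obtain ⟨i, hi⟩ : ∃ i, pderiv i l ≠ 0 := by
    by_contra! h0
    refine hl0 ?_
    rw [← one_nsmul l, ← hl.sum_X_mul_pderiv]
    exact Finset.sum_eq_zero fun i _ => by rw [h0, mul_zero]
  obtain ⟨a, ha⟩ := hconst hl i
  have ha0 : a ≠ 0 := by rintro rfl; exact hi (by rw [ha, C_0])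
  have hq2 := parallel_gradient hl hq h i
  have hqi : (pderiv i q).IsHomogeneous 1 := hq.pderiv
  have hli : ∀ j j', pderiv j (pderiv j' l) = 0 := fun j j' => by
    obtain ⟨b, hb⟩ := hconst hl j'
    rw [hb, pderiv_C]
  -- Differentiating the parallelism of `l` and `q` along `i` shows that `l` and `∂ᵢ q` are parallel.
  have h' : ∀ j j', pderiv j l * pderiv j' (pderiv i q) = pderiv j' l * pderiv j (pderiv i q) := by
    intro j j'
    have := congrArg (pderiv i) (h j j')
    rw [pderiv_mul, pderiv_mul, hli, hli, zero_mul, zero_mul, zero_add, zero_add] at this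
    rwa [pderiv_comm j', pderiv_comm j]
  have hq1 := parallel_gradient hl hqi h' i
  obtain ⟨b, hb⟩ := hconst hqi i
  rw [ha, hb] at hq1
  rw [ha] at hq2
  have hinv : (C (2 * a * a)⁻¹ * (2 * C a * C a) : MvPolynomial σ k) = 1 := by
    rw [← map_ofNat C 2, ← C_mul, ← C_mul, ← C_mul, inv_mul_cancel₀ (by simp [h2, ha0]), C_1]
  refine ⟨(2 * a * a)⁻¹ * b, ?_⟩
  push_cast at hq1 hq2
  rw [C_mul]
  linear_combination C (2 * a * a)⁻¹ * (C a * hq2 + l * hq1) - q * hinv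

/-- A reducible cubic has a linear factor `l`, with cofactor `q`. Then `l` is normal, with log-ozone
derivation given by `∇l × ∇q`, and the vanishing of this cross product makes `q` a multiple of
`l ^ 2`. -/
theorem isomorphic_X_pow_of_not_irreducible (h2 : (2 : k) ≠ 0) {Ω : MvPolynomial (Fin 3) k}
    (hΩ : Ω.IsHomogeneous 3) (h0 : Ω ≠ 0) (hirr : ¬ Irreducible Ω)
    (hloz : (ofPotential Ω).loz = {0}) :
    (ofPotential Ω).Isomorphic (ofPotential (X 0 ^ 3 : MvPolynomial (Fin 3) k)) := by
  obtain ⟨l, q, hl, hq, rfl⟩ := exists_eq_mul_of_not_irreducible hΩ h0 hirr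
  have hl0 := left_ne_zero_of_mul h0
  rw [loz_eq_zero_iff] at hloz
  have hbr : ∀ a, (ofPotential (l * q)).br a l = l *
      ((pderiv 0 a * pderiv 1 l - pderiv 1 a * pderiv 0 l) * pderiv 2 q +
      (pderiv 1 a * pderiv 2 l - pderiv 2 a * pderiv 1 l) * pderiv 0 q +
      (pderiv 2 a * pderiv 0 l - pderiv 0 a * pderiv 2 l) * pderiv 1 q) := fun a => by
    simp only [ofPotential, LinearMap.mk₂_apply, pderiv_mul]
    ring
  have hcas := hloz l fun a => ⟨_, hbr a⟩
  have hcas' := fun a => (mul_eq_zero.1 ((hbr a).symm.trans (hcas a))).resolve_left hl0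
  have c0 := hcas' (X 0)
  have c1 := hcas' (X 1)
  have c2 := hcas' (X 2)
  simp only [pderiv_X_self,
    pderiv_X_of_ne (show (0 : Fin 3) ≠ 1 by decide),
    pderiv_X_of_ne (show (0 : Fin 3) ≠ 2 by decide),
    pderiv_X_of_ne (show (1 : Fin 3) ≠ 0 by decide),
    pderiv_X_of_ne (show (1 : Fin 3) ≠ 2 by decide),
    pderiv_X_of_ne (show (2 : Fin 3) ≠ 0 by decide),
    pderiv_X_of_ne (show (2 : Fin 3) ≠ 1 by decide)] at c0 c1 c2
  obtain ⟨c, rfl⟩ := exists_eq_C_mul_pow_of_parallel h2 hl0 hl hq (by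
    intro i j
    fin_cases i <;> fin_cases j
    · rfl
    · change pderiv 0 l * pderiv 1 q = pderiv 1 l * pderiv 0 q
      linear_combination c2
    · change pderiv 0 l * pderiv 2 q = pderiv 2 l * pderiv 0 q
      linear_combination -c1
    · change pderiv 1 l * pderiv 0 q = pderiv 0 l * pderiv 1 q
      linear_combination -c2
    · rfl
    · change pderiv 1 l * pderiv 2 q = pderiv 2 l * pderiv 1 q
      linear_combination c0
    · change pderiv 2 l * pderiv 0 q = pderiv 0 l * pderiv 2 q
      linear_combination c1
    · change pderiv 2 l * pderiv 1 q = pderiv 1 l * pderiv 2 q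
      linear_combination -c0
    · rfl)
  have hc : c ≠ 0 := by rintro rfl; simp at h0
  rw [show l * (C c * l ^ 2) = C c * l ^ 3 by ring]
  exact ofPotential_cube_isomorphic hl hl0 hc

end Reducible

end PoissonBracket

/-! ### The characterization -/

theorem theorem4p7 {k : Type*} [Field k] (p : ℕ) [CharP k p] (hp : 3 < p)
    (P : PoissonBracket k (MvPolynomial (Fin 3) k)) (hgr : P.IsGraded)
    (hne : ∃ f g, P.br f g ≠ 0) :
    (P.loz = {0} ↔
      P.IsUnimodular ∧
        ∃ Ω : MvPolynomial (Fin 3) k, Ω.IsHomogeneous 3 ∧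
          (Irreducible Ω ∨ Ω = MvPolynomial.X 0 ^ 3) ∧
          P.Isomorphic (PoissonBracket.ofPotential Ω)) ∧
    (¬ P.IsUnimodular → P.modular ∈ P.loz ∧ P.loz ≠ {0}) := by
  have h3 : (3 : k) ≠ 0 := by
    exact_mod_cast PoissonBracket.natCast_ne_zero_of_lt (k := k) p (n := 3) (by norm_num) hp
  have h2 : (2 : k) ≠ 0 := by
    exact_mod_cast PoissonBracket.natCast_ne_zero_of_lt (k := k) p (n := 2) (by norm_num) (by omega)
  have hmod := PoissonBracket.modular_mem_loz p hp P hgr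
  have hnot : ¬ P.IsUnimodular → P.loz ≠ {0} := fun hu h => by
    rw [h] at hmod
    exact hu hmod
  refine ⟨⟨fun hloz => ?_, ?_⟩, fun hu => ⟨hmod, hnot hu⟩⟩
  · have hu : P.IsUnimodular := by_contra fun hu => hnot hu hloz
    refine ⟨hu, ?_⟩
    have hiso := PoissonBracket.isomorphic_ofPotential_cubic h3 P hgr hu
    have hhom : (C 3⁻¹ * P.cubic).IsHomogeneous 3 := (P.isHomogeneous_cubic hgr).C_mul _
    by_cases hirr : Irreducible (C 3⁻¹ * P.cubic)
    · exact ⟨_, hhom, Or.inl hirr, hiso⟩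
    · refine ⟨X 0 ^ 3, isHomogeneous_X_pow _ _, Or.inr rfl, ?_⟩
      refine hiso.trans (PoissonBracket.isomorphic_X_pow_of_not_irreducible h2 hhom ?_ hirr
        (hiso.symm.loz_eq_zero hloz))
      intro h0
      obtain ⟨f, g, hfg⟩ := hne
      obtain ⟨e, he⟩ := hiso
      refine hfg (e.injective ?_)
      rw [he, map_zero, h0]
      simp [PoissonBracket.ofPotential]
  · rintro ⟨-, Ω, hΩ, hirr | rfl, hiso⟩
    · exact hiso.loz_eq_zero (PoissonBracket.loz_ofPotential_of_irreducible h3 hΩ hirr)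
    · exact hiso.loz_eq_zero (PoissonBracket.loz_ofPotential_X_pow h3)
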